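/- Let $X=\{x\in\mathbb T^{\mathbb Z^2} : x_{(m+1,n)}-2x_{(m,n)}=0 \text{ in } \mathbb T \text{ for all } m,n\in\mathbb Z\}$, where $\mathbb T=\mathbb R/\mathbb Z$, be the compact group defined by the non-constant polynomial $f(x,y)=x-2$, with the shift action of $\mathbb Z^2$, $((m,n)\cdot x)_{(k,\ell)}=x_{(m+k,n+\ell)}$. For a finite-index subgroup $L\le\mathbb Z^2$ write $[L]$ for its index, $\mathsf F(L)$ for the number of points of $X$ fixed by every element of $L$, and $\mathsf O(L)=\frac1{[L]}|\{x\in X:\operatorname{Stab}(x)=L\}|$ for the number of $L$-periodic orbits. Let $h$ be the topological entropy of the action, let $$g=\lim_{N\to\infty}\ \sup_{[L]\ge N}\frac1{[L]}\log\mathsf F(L),\qquad \mathcal M(N)=\sum_{[L]\le N}\frac{\mathsf O(L)}{e^{g[L]}},$$ and for a compact subgroup $K\le\mathbb T^2$ with normalised Haar measure $m_K$ let $\mathsf m(K)=\int_K\log|e^{2\pi i s}-2|\,dm_K(s,t)$. Then: 1. $h=\log 2$ and $\mathsf m(\mathbb T^2)=\log 2$ (the Mahler measure of $f$). 2. For $a\ge1$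 and $J(a)=\{(j/a,t): t\in\mathbb T,\ 0\le j<a\}$, $\mathsf m(J(a))=\frac1a\log(2^a-1)$. For $c\ge1$, $b\ge0$ and $J(b,c)=\{(t,\frac kc-\frac{bt}c): t\in\mathbb R,\ k\in\mathbb Z\}$ (read modulo $\mathbb Z^2$), $\mathsf m(J(b,c))=\log 2$. 3. $g=\log 2$, and $\sup\mathsf m(K)=\log 2$, the supremum being over the infinite compact subgroups $K$ of $\mathbb T^2$. 4. For $a,c\ge1$ and $0\le b\le a-1$, with $L(a,b,c)=\langle(a,0),(b,c)\rangle$, $\mathsf F(L(a,b,c))=(2^a-1)^c$. 5. There are constants $C_{11},C_{12}>0$ such that $C_{11}N\le\mathcal M(N)\le C_{12}N$ for all sufficiently large $N$. -/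

import Mathlib

open Filter Topology Uniformity MeasureTheory
open scoped ENNReal

noncomputable section

namespace OrbitGrowth

section Counting

variable {G : Type*} [AddGroup G] (X : Type*) [AddAction G X]

/-- `F(L)`: the number of points of `X` fixed by every element of `L`. -/
def periodicCount (L : AddSubgroup G) : ℕ∞ :=
  {x : X | ∀ l ∈ L, l +ᵥ x = x}.encard

/-- `O(L)`: the number of `L`-periodic orbits, that is the number of points whose stabilizer is
exactly `L`, divided by the index `[L]`. -/
def orbitCount (L : AddSubgroup G) : ℝ≥0∞ :=
  ({x : X | AddAction.stabilizer G x = L}.encard : ℝ≥0∞) / (L.index : ℝ≥0∞)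

variable (G) in
/-- `g`: the limit, as `N → ∞`, of the supremum of `(1 / [L]) log F(L)` over the finite-index
subgroups `L` with `[L] ≥ N` (a non-increasing sequence in `N`, so the limit is the infimum). -/
def upperGrowthRate : EReal :=
  ⨅ N : ℕ, ⨆ L : {L : AddSubgroup G // L.FiniteIndex ∧ N ≤ L.index},
    ENNReal.log (periodicCount X L.1 : ℝ≥0∞) / ((L.1.index : ℕ) : EReal)

variable (G) in
/-- `𝓜(N)`: the sum of `O(L) / e^{g [L]}` over the subgroups `L` of index at most `N`. -/
def weightedOrbitSum (N : ℕ) : ℝ≥0∞ :=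
  ∑' L : {L : AddSubgroup G // L.FiniteIndex ∧ L.index ≤ N},
    orbitCount X L.1 / EReal.exp (upperGrowthRate G X * ((L.1.index : ℕ) : EReal))

end Counting

section Entropy

variable (X : Type*) [UniformSpace X] [AddAction (ℤ × ℤ) X]

/-- The square `{0, …, n - 1}²` in `ℤ²`. -/
def box (n : ℕ) : Set (ℤ × ℤ) := Set.Ico 0 (n : ℤ) ×ˢ Set.Ico 0 (n : ℤ)

/-- `s` is `(n, U)`-spanning: every point stays `U`-close to some point of `s` along the box. -/
def IsSpanning (U : Set (X × X)) (n : ℕ) (s : Set X) : Prop :=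
  ∀ x : X, ∃ y ∈ s, ∀ k ∈ box n, (k +ᵥ x, k +ᵥ y) ∈ U

/-- The least cardinality of an `(n, U)`-spanning set. -/
def spanningNumber (U : Set (X × X)) (n : ℕ) : ℕ∞ :=
  ⨅ s : {s : Set X // IsSpanning X U n s}, s.1.encard

/-- Topological entropy of a `ℤ²`-action (Bowen's definition by spanning sets). -/
def topologicalEntropy : EReal :=
  ⨆ U ∈ 𝓤 X, limsup
    (fun n : ℕ => ENNReal.log (spanningNumber X U n : ℝ≥0∞) / ((n ^ 2 : ℕ) : EReal)) atTop

end Entropy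

/-- The ring `ℤ[x^{±1}, y^{±1}]`; `(a, b)` is the exponent of the monomial `x^a y^b`. -/
abbrev LaurentPoly : Type := AddMonoidAlgebra ℤ (ℤ × ℤ)

/-- The Laurent polynomial `x - 2`. -/
def xSubTwo : LaurentPoly := AddMonoidAlgebra.single (1, 0) 1 - AddMonoidAlgebra.single (0, 0) 2

/-- `X_f`: the compact group of the `x ∈ 𝕋^{ℤ²}` with `∑ c_k x_{k + m} = 0` in `𝕋` for all
`m ∈ ℤ²`, where `f = ∑ c_k X^k`. -/
def principalSystem (f : LaurentPoly) : AddSubgroup (ℤ × ℤ → UnitAddCircle) where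
  carrier := {x | ∀ m : ℤ × ℤ, ∑ k ∈ f.coeff.support, f.coeff k • x (k + m) = 0}
  zero_mem' := by simp
  add_mem' := by
    intro x y hx hy m
    simp only [Pi.add_apply, smul_add, Finset.sum_add_distrib, hx m, hy m, add_zero]
  neg_mem' := by
    intro x hx m
    simp only [Pi.neg_apply, smul_neg, Finset.sum_neg_distrib, hx m, neg_zero]

/-- The shift action of `ℤ²` on `X_f`: `(m · x)_k = x_{m + k}`. -/
instance shiftAction (f : LaurentPoly) : AddAction (ℤ × ℤ) (principalSystem f) where
  vadd m x := ⟨fun k => x.1 (m + k), fun n => by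
    have h := x.2 (m + n)
    simpa only [add_left_comm] using h⟩
  zero_vadd x := Subtype.ext (funext fun k => congrArg x.1 (zero_add k))
  add_vadd m n x := Subtype.ext (funext fun k => congrArg x.1 (by abel))

theorem shift_apply (f : LaurentPoly) (m k : ℤ × ℤ) (x : principalSystem f) :
    (m +ᵥ x).1 k = x.1 (m + k) := rfl

/-- `L(a, b, c)`: the subgroup of `ℤ²` generated by `(a, 0)` and `(b, c)`. -/
def lattice (a b c : ℕ) : AddSubgroup (ℤ × ℤ) :=
  AddSubgroup.closure {((a : ℤ), (0 : ℤ)), ((b : ℤ), (c : ℤ))}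

/-- The torus `𝕋² = ℝ²/ℤ²`. -/
abbrev Torus : Type := UnitAddCircle × UnitAddCircle

/-- `L_f(s, t) = log |f(e^{2πis}, e^{2πit})|`. -/
def logAbs (f : LaurentPoly) (p : Torus) : ℝ :=
  Real.log ‖∑ k ∈ f.coeff.support,
    (f.coeff k : ℂ) * ((p.1.toCircle ^ k.1 * p.2.toCircle ^ k.2 : Circle) : ℂ)‖

instance compactSpace_closed (K : ClosedAddSubgroup Torus) : CompactSpace K.toAddSubgroup :=
  isCompact_iff_compactSpace.mp K.isClosed'.isCompact

/-- `𝗆(K)`: the integral of `L_f` over the compact subgroup `K` of `𝕋²` with respect to the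
Haar probability measure of `K`. -/
def haarMean (f : LaurentPoly) (K : ClosedAddSubgroup Torus) : ℝ :=
  ∫ p : K.toAddSubgroup, logAbs f p.1
    ∂(Measure.addHaarMeasure (⊤ : TopologicalSpace.PositiveCompacts K.toAddSubgroup))

/-- The whole torus as a closed subgroup of itself. -/
def wholeTorus : ClosedAddSubgroup Torus := ⟨⊤, isClosed_univ⟩

/-- `J(a) = {(j/a, t) : t ∈ 𝕋, j ∈ ℤ}`, written as the subgroup of `(s, t)` with `a s = 0`. -/
def J₁ (a : ℕ) : ClosedAddSubgroup Torus where
  carrier := {p | a • p.1 = 0}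
  zero_mem' := by simp
  add_mem' := by
    intro p q hp hq
    simp only [Set.mem_ofPred_eq, Prod.fst_add, smul_add] at *
    rw [hp, hq, add_zero]
  neg_mem' := by
    intro p hp
    simp only [Set.mem_ofPred_eq, Prod.fst_neg, smul_neg] at *
    rw [hp, neg_zero]
  isClosed' := isClosed_eq ((continuous_nsmul a).comp continuous_fst) continuous_const

/-- `J(b, c) = {(t, k/c - bt/c) : t ∈ ℝ, k ∈ ℤ}`, written as the subgroup of `(s, t)` with
`b s + c t = 0`. -/
def J₂ (b c : ℕ) : ClosedAddSubgroup Torus where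
  carrier := {p | b • p.1 + c • p.2 = 0}
  zero_mem' := by simp
  add_mem' := by
    intro p q hp hq
    simp only [Set.mem_ofPred_eq, Prod.fst_add, Prod.snd_add, smul_add] at *
    rw [add_add_add_comm, hp, hq, add_zero]
  neg_mem' := by
    intro p hp
    simp only [Set.mem_ofPred_eq, Prod.fst_neg, Prod.snd_neg, smul_neg] at *
    rw [← neg_add, hp, neg_zero]
  isClosed' := isClosed_eq (((continuous_nsmul b).comp continuous_fst).add
    ((continuous_nsmul c).comp continuous_snd)) continuous_const

theorem exists_div_of_nsmul {n : ℕ} (hn : 1 ≤ n) (r : ℝ) (s : UnitAddCircle)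
    (h : n • s = (r : UnitAddCircle)) :
    ∃ j : ℤ, s = (((j : ℝ) / n + r / n : ℝ) : UnitAddCircle) := by
  induction s using QuotientAddGroup.induction_on with
  | H u =>
    have h1 : ((n • u - r : ℝ) : UnitAddCircle) = 0 := by
      rw [AddCircle.coe_sub, AddCircle.coe_nsmul]
      exact sub_eq_zero.mpr h
    obtain ⟨j, hj⟩ := (AddCircle.coe_eq_zero_iff (1 : ℝ)).mp h1
    refine ⟨j, ?_⟩
    have hn' : (n : ℝ) ≠ 0 := by positivity
    have : u = (j : ℝ) / n + r / n := by
      simp only [zsmul_eq_mul, mul_one, nsmul_eq_mul] at hj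
      field_simp
      linarith
    exact congrArg _ this

theorem nsmul_div {n : ℕ} (hn : 1 ≤ n) (j : ℤ) (r : ℝ) :
    n • (((j : ℝ) / n + r / n : ℝ) : UnitAddCircle) = (r : UnitAddCircle) := by
  have hn' : (n : ℝ) ≠ 0 := by positivity
  have h1 : n • ((j : ℝ) / n + r / n) = j • (1 : ℝ) + r := by
    simp only [zsmul_eq_mul, mul_one, nsmul_eq_mul]
    field_simp
  have h2 : ((j • (1 : ℝ) : ℝ) : UnitAddCircle) = 0 :=
    (AddCircle.coe_eq_zero_iff (1 : ℝ)).mpr ⟨j, rfl⟩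
  rw [← AddCircle.coe_nsmul, h1, AddCircle.coe_add, h2, zero_add]

theorem mem_J₁ {a : ℕ} (ha : 1 ≤ a) (p : Torus) :
    p ∈ J₁ a ↔ ∃ (j : ℤ) (t : UnitAddCircle), p = ((((j : ℝ) / a : ℝ) : UnitAddCircle), t) := by
  constructor
  · intro h
    obtain ⟨j, hj⟩ := exists_div_of_nsmul ha 0 p.1 (by simpa using (show a • p.1 = 0 from h))
    exact ⟨j, p.2, Prod.ext (by simpa using hj) rfl⟩
  · rintro ⟨j, t, rfl⟩
    have := nsmul_div ha j 0
    change a • (((j : ℝ) / a : ℝ) : UnitAddCircle) = 0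
    simpa using this

theorem mem_J₂ {b c : ℕ} (hc : 1 ≤ c) (p : Torus) :
    p ∈ J₂ b c ↔ ∃ (k : ℤ) (t : ℝ),
      p = ((t : UnitAddCircle), (((k : ℝ) / c - b * t / c : ℝ) : UnitAddCircle)) := by
  constructor
  · intro h
    obtain ⟨s, u⟩ := p
    have h' : b • s + c • u = 0 := h
    induction s using QuotientAddGroup.induction_on with
    | H t =>
      obtain ⟨k, hk⟩ := exists_div_of_nsmul hc (-(b * t)) u (by
        rw [AddCircle.coe_neg, ← nsmul_eq_mul, AddCircle.coe_nsmul]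
        exact eq_neg_of_add_eq_zero_right h')
      have e : (k : ℝ) / c + -(b * t) / c = (k : ℝ) / c - b * t / c := by ring
      exact ⟨k, t, Prod.ext rfl (by rw [hk, e])⟩
  · rintro ⟨k, t, rfl⟩
    have h := nsmul_div hc k (-(b * t))
    have e : (k : ℝ) / c - b * t / c = (k : ℝ) / c + -(b * t) / c := by ring
    change b • (t : UnitAddCircle) + c • (((k : ℝ) / c - b * t / c : ℝ) : UnitAddCircle) = 0
    rw [e, h, AddCircle.coe_neg, ← nsmul_eq_mul, AddCircle.coe_nsmul, add_neg_cancel]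

end OrbitGrowth

end

open Filter Topology Uniformity MeasureTheory
open scoped ENNReal

namespace OrbitGrowth

/-! A point of the system is a family of independent rows, each a two-sided orbit of doubling on the
circle. Everything follows from this.

Periodic points: a finite-index subgroup has a Hermite normal form `lattice a b c`, of index `a *
c`. A point fixed by it is determined by freely chosen `(2 ^ a - 1)`-torsion entries at column `0`
of rows `0, …, c - 1` (`fixedEquiv`), whence `(2 ^ a - 1) ^ c`. The normalised logarithm `log (2 ^ a
- 1) / a` stays below `log 2` and tends to it as `a` grows, so `g = log 2`.

Orbit sum: each lattice contributes at most `1 / (a * c)`. There are `a` values of `b`, so the sum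
is at most `∑ 1 / c` over `a * c ≤ N`, which is at most `N * ∑ 1 / c ^ 2`. Conversely the lattices
with `c = 1` suffice: at least `2 ^ a / 4` points have exact stabilizer `lattice a b 1`
(`card_exact_period`), so each `a ≤ N` contributes at least `1 / 4`.

Haar means: on the unit circle `log 2 - log |z - 2| = ∑ Re (z ^ n) / (n 2 ^ n)` over `n ≥ 1`.
Integrated over `K`, only those `n` survive that annihilate the first coordinates of `K`
(`hasSum_haarMean`). All terms are nonnegative, so `log 2` is an upper bound, attained when `K`
projects onto the first circle; for `J₁ a` the multiples of `a` survive and sum to a logarithm.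

Entropy: over an `n × n` box, about `n` binary digits in each of about `n` rows are necessary and
sufficient to describe a point (`le_spanningNumber`, `spanningNumber_le`). -/

theorem xSubTwo_coeff_zero : xSubTwo.coeff (0, 0) = -2 := by
  simp [xSubTwo, AddMonoidAlgebra.coeff_sub]

theorem xSubTwo_coeff_one : xSubTwo.coeff (1, 0) = 1 := by
  simp [xSubTwo, AddMonoidAlgebra.coeff_sub]

theorem xSubTwo_support : xSubTwo.coeff.support = {((1, 0) : ℤ × ℤ), (0, 0)} := by
  ext k
  rw [Finsupp.mem_support_iff]
  by_cases h1 : k = (1, 0)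
  · subst h1; simp [xSubTwo_coeff_one]
  by_cases h0 : k = (0, 0)
  · subst h0; simp [xSubTwo_coeff_zero]
  · simp [xSubTwo, AddMonoidAlgebra.coeff_sub, h1, h0]

theorem xSubTwo_ne_single (n : ℤ) : xSubTwo ≠ AddMonoidAlgebra.single (0, 0) n := by
  intro h
  have := xSubTwo_coeff_one
  rw [h] at this
  simp at this

theorem mem_principalSystem_xSubTwo {x : ℤ × ℤ → UnitAddCircle} :
    x ∈ principalSystem xSubTwo ↔ ∀ m n : ℤ, x (m + 1, n) = 2 • x (m, n) := by
  have key : ∀ m : ℤ × ℤ, ∑ k ∈ xSubTwo.coeff.support, xSubTwo.coeff k • x (k + m) =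
      x (m.1 + 1, m.2) - 2 • x (m.1, m.2) := by
    intro m
    rw [xSubTwo_support, Finset.sum_pair (by simp), xSubTwo_coeff_one, xSubTwo_coeff_zero,
      one_smul, neg_smul, ← sub_eq_add_neg]
    have h1 : ((1, 0) : ℤ × ℤ) + m = (m.1 + 1, m.2) := by ext <;> simp [add_comm]
    have h0 : ((0, 0) : ℤ × ℤ) + m = (m.1, m.2) := by ext <;> simp
    rw [h1, h0]
    norm_cast
  change (∀ m : ℤ × ℤ, _ = _) ↔ _
  simp only [key, sub_eq_zero, Prod.forall]

theorem principalSystem_apply_add (x : principalSystem xSubTwo) (m n : ℤ) (k : ℕ) :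
    x.1 (m + k, n) = 2 ^ k • x.1 (m, n) := by
  induction k with
  | zero => simp
  | succ k ih =>
    have h := mem_principalSystem_xSubTwo.1 x.2 (m + k) n
    rw [Nat.cast_succ, ← add_assoc, h, ih, smul_smul, pow_succ']

/-! ### Finite-index subgroups of `ℤ²` and their Hermite normal form. -/

theorem mem_lattice {a b c : ℕ} {p : ℤ × ℤ} :
    p ∈ lattice a b c ↔ ∃ i j : ℤ, p.1 = i * a + j * b ∧ p.2 = j * c := by
  rw [lattice, AddSubgroup.mem_closure_pair]
  constructor
  · rintro ⟨i, j, rfl⟩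
    exact ⟨i, j, by simp, by simp⟩
  · rintro ⟨i, j, h1, h2⟩
    exact ⟨i, j, Prod.ext (by simp [h1]) (by simp [h2])⟩

theorem index_lattice {a c : ℕ} (b : ℕ) (ha : 1 ≤ a) (hc : 1 ≤ c) :
    (lattice a b c).index = a * c := by
  -- The rectangle `[0, a) × [0, c)` is a fundamental domain for the lattice.
  have hbij : Function.Bijective (fun p : Fin a × Fin c =>
      (QuotientAddGroup.mk (((p.1 : ℕ) : ℤ), ((p.2 : ℕ) : ℤ)) : (ℤ × ℤ) ⧸ lattice a b c)) := by
    constructor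
    · rintro ⟨i, j⟩ ⟨i', j'⟩ h
      obtain ⟨u, v, h1, h2⟩ := mem_lattice.1 (QuotientAddGroup.eq.1 h)
      simp only [Prod.fst_add, Prod.snd_add, Prod.fst_neg, Prod.snd_neg] at h1 h2
      have hj : ((j : ℕ) : ℤ) = (j' : ℕ) := by
        have : ((j : ℕ) : ℤ) % c = ((j' : ℕ) : ℤ) % c :=
          (Int.emod_eq_emod_iff_emod_sub_eq_zero).2
              (Int.emod_eq_zero_of_dvd ⟨-v, by linarith⟩)
        rwa [Int.emod_eq_of_lt (by positivity) (by exact_mod_cast j.2),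
          Int.emod_eq_of_lt (by positivity) (by exact_mod_cast j'.2)] at this
      have hv : v = 0 := by
        rw [hj] at h2
        have : v * (c : ℤ) = 0 := by linarith
        rcases mul_eq_zero.1 this with h | h
        · exact h
        · omega
      subst hv
      have hi : ((i : ℕ) : ℤ) = (i' : ℕ) := by
        have : ((i : ℕ) : ℤ) % a = ((i' : ℕ) : ℤ) % a :=
          (Int.emod_eq_emod_iff_emod_sub_eq_zero).2
              (Int.emod_eq_zero_of_dvd ⟨-u, by linarith⟩)
        rwa [Int.emod_eq_of_lt (by positivity) (by exact_mod_cast i.2),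
          Int.emod_eq_of_lt (by positivity) (by exact_mod_cast i'.2)] at this
      exact Prod.ext (Fin.ext (by exact_mod_cast hi)) (Fin.ext (by exact_mod_cast hj))
    · intro q
      induction q using QuotientAddGroup.induction_on with
      | H p =>
        obtain ⟨m, n⟩ := p
        have ha' : (0 : ℤ) < a := by exact_mod_cast ha
        have hc' : (0 : ℤ) < c := by exact_mod_cast hc
        have e1 := Int.emod_nonneg (m - n / c * b) ha'.ne'
        have e2 := Int.emod_lt_of_pos (m - n / c * b) ha'
        have e3 := Int.emod_nonneg n hc'.ne'
        have e4 := Int.emod_lt_of_pos n hc'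
        refine ⟨(⟨((m - n / c * b) % a).toNat, by omega⟩, ⟨(n % c).toNat, by omega⟩), ?_⟩
        refine QuotientAddGroup.eq.2 (mem_lattice.2 ⟨(m - n / c * b) / a, n / c, ?_, ?_⟩)
        · simp only [Prod.fst_add, Prod.fst_neg, Int.toNat_of_nonneg e1]
          have := Int.emod_add_mul_ediv (m - n / c * b) a
          linarith
        · simp only [Prod.snd_add, Prod.snd_neg, Int.toNat_of_nonneg e3]
          have := Int.emod_add_mul_ediv n c
          linarith
  rw [AddSubgroup.index_eq_card, ← Nat.card_eq_of_bijective _ hbij]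
  simp

/-- Here `a` generates the intersection of `L` with the horizontal axis and `c` its projection to
the vertical axis. Neither is `0`, because `L.index • p ∈ L` for all `p`. A lift of `c` to `L` has
its first coordinate reduced modulo `a`. -/
theorem exists_eq_lattice (L : AddSubgroup (ℤ × ℤ)) (hL : L.FiniteIndex) :
    ∃ a b c : ℕ, 1 ≤ a ∧ 1 ≤ c ∧ b < a ∧ L = lattice a b c := by
  have gen : ∀ H : AddSubgroup ℤ, ∃ d : ℕ, ∀ n, n ∈ H ↔ (d : ℤ) ∣ n := by
    intro H
    obtain ⟨d, hd⟩ := Int.subgroup_cyclic H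
    refine ⟨d.natAbs, fun n => ?_⟩
    rw [hd, ← AddSubgroup.zmultiples_eq_closure, Int.mem_zmultiples_iff, Int.natAbs_dvd]
  obtain ⟨a, ha⟩ := gen (L.comap (AddMonoidHom.inl ℤ ℤ))
  obtain ⟨c, hc⟩ := gen (L.map (AddMonoidHom.snd ℤ ℤ))
  simp only [AddSubgroup.mem_comap, AddMonoidHom.inl_apply, AddSubgroup.mem_map,
    AddMonoidHom.coe_snd] at ha hc
  have hmem : ∀ p : ℤ × ℤ, L.index • p ∈ L := fun p => AddSubgroup.nsmul_index_mem L p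
  have hidx : L.index ≠ 0 := hL.index_ne_zero
  have ha1 : 1 ≤ a := by
    rcases Nat.eq_zero_or_pos a with h | h
    · have := (ha L.index).1 (by simpa using hmem (1, 0))
      simp [h, hidx] at this
    · exact h
  have hc1 : 1 ≤ c := by
    rcases Nat.eq_zero_or_pos c with h | h
    · have := (hc L.index).1 ⟨_, hmem (0, 1), by simp⟩
      simp [h, hidx] at this
    · exact h
  obtain ⟨⟨b₀, c₀⟩, hb₀, rfl : c₀ = c⟩ := (hc c).2 dvd_rfl
  have ha' : (0 : ℤ) < a := by exact_mod_cast ha1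
  have e1 := Int.emod_nonneg b₀ ha'.ne'
  have e2 := Int.emod_lt_of_pos b₀ ha'
  have hbc : (b₀ % a, (c : ℤ)) ∈ L := by
    have h1 : ((-(b₀ / a * a), 0) : ℤ × ℤ) ∈ L := (ha _).2 ⟨-(b₀ / a), by ring⟩
    have h2 := L.add_mem hb₀ h1
    have e : ((b₀, (c : ℤ)) : ℤ × ℤ) + (-(b₀ / a * a), 0) = (b₀ % a, (c : ℤ)) :=
      Prod.ext (by
        have := Int.emod_add_mul_ediv b₀ a
        simp only [Prod.fst_add]; linarith) (by simp)
    rwa [e] at h2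
  refine ⟨a, (b₀ % a).toNat, c, ha1, hc1, by omega, le_antisymm ?_ ?_⟩
  · rintro ⟨m, n⟩ hmn
    obtain ⟨j, rfl⟩ := (hc n).1 ⟨_, hmn, rfl⟩
    have h1 := L.sub_mem hmn (L.zsmul_mem hbc j)
    have e : ((m, (c : ℤ) * j) : ℤ × ℤ) - j • (b₀ % a, (c : ℤ)) = (m - j * (b₀ % a), 0) :=
      Prod.ext (by simp) (by simp [mul_comm])
    rw [e] at h1
    obtain ⟨i, hi⟩ := (ha _).1 h1
    refine mem_lattice.2 ⟨i, j, ?_, by simp [mul_comm]⟩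
    rw [Int.toNat_of_nonneg e1]
    simp only
    linarith
  · rw [lattice, AddSubgroup.closure_le]
    rintro p (rfl | rfl)
    · exact (ha _).2 dvd_rfl
    · rw [Int.toNat_of_nonneg e1]; exact hbc

/-! ### Counting periodic points. -/

/-- The circle has exactly `n` points of `n`-torsion. -/
theorem natCard_nsmul_eq_zero {n : ℕ} (hn : 0 < n) :
    Nat.card {u : UnitAddCircle // n • u = 0} = n := by
  have : NeZero n := ⟨hn.ne'⟩
  have hbij : Function.Bijective (fun j : ZMod n =>
      (⟨ZMod.toAddCircle j, by rw [← map_nsmul]; simp⟩ : {u : UnitAddCircle // n • u = 0})) := by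
    constructor
    · intro j k h
      exact ZMod.toAddCircle_injective n (Subtype.ext_iff.1 h)
    · rintro ⟨u, hu⟩
      obtain ⟨m, -, hm⟩ := (AddCircle.nsmul_eq_zero_iff hn).1 hu
      refine ⟨(m : ZMod n), Subtype.ext ?_⟩
      simpa [ZMod.toAddCircle_natCast] using hm
  rw [← Nat.card_eq_of_bijective _ hbij, Nat.card_zmod]

theorem fixed_lattice_iff {a b c : ℕ} {x : principalSystem xSubTwo} :
    (∀ l ∈ lattice a b c, l +ᵥ x = x) ↔
      (∀ m n : ℤ, x.1 (m + a, n) = x.1 (m, n)) ∧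
        ∀ m n : ℤ, x.1 (m + b, n + c) = x.1 (m, n) := by
  have key : ∀ l : ℤ × ℤ, l +ᵥ x = x ↔ ∀ m n : ℤ, x.1 (m + l.1, n + l.2) = x.1 (m, n) := by
    intro l
    constructor
    · intro h m n
      have := congrArg (fun y : principalSystem xSubTwo => y.1 (m, n)) h
      simp only [shift_apply] at this
      rw [← this]
      exact congrArg x.1 (by ext <;> simp [add_comm])
    · intro h
      refine Subtype.ext (funext fun k => ?_)
      rw [shift_apply, ← h k.1 k.2]
      exact congrArg x.1 (by ext <;> simp [add_comm])
  constructor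
  · intro h
    constructor
    · simpa using (key _).1 (h ((a : ℤ), 0) (AddSubgroup.subset_closure (by simp)))
    · exact (key _).1 (h ((b : ℤ), (c : ℤ)) (AddSubgroup.subset_closure (by simp)))
  · rintro ⟨h1, h2⟩ l hl
    have : lattice a b c ≤ AddAction.stabilizer (ℤ × ℤ) x := by
      rw [lattice, AddSubgroup.closure_le]
      rintro p (rfl | rfl)
      · exact (key _).2 (by simpa using h1)
      · exact (key _).2 h2
    exact this hl

theorem two_pow_nsmul_eq_self {a : ℕ} {t : UnitAddCircle} :
    2 ^ a • t = t ↔ (2 ^ a - 1) • t = 0 := by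
  have h : (2 ^ a - 1) • t + t = 2 ^ a • t := by
    rw [← succ_nsmul, Nat.sub_add_cancel Nat.one_le_two_pow]
  rw [← h, add_eq_right]

/-- The exponent may be read modulo `a`: when the residue wraps from `a - 1` to `0`, the relation `2
^ a • t = t` absorbs the jump. -/
theorem two_pow_emod_nsmul_add_one {a : ℕ} (ha : 1 ≤ a) {t : UnitAddCircle}
    (ht : 2 ^ a • t = t) (k : ℤ) :
    2 ^ (((k + 1) % a).toNat) • t = 2 • 2 ^ ((k % a).toNat) • t := by
  have ha' : (0 : ℤ) < a := by exact_mod_cast ha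
  have e1 := Int.emod_nonneg k ha'.ne'
  have e2 := Int.emod_lt_of_pos k ha'
  rw [smul_smul, ← pow_succ']
  rcases lt_or_eq_of_le (Int.add_one_le_of_lt e2) with h | h
  · have : (k + 1) % a = k % a + 1 := by
      rw [← Int.emod_add_emod, Int.emod_eq_of_lt (by omega) h]
    rw [this, Int.toNat_add e1 zero_le_one]
    rfl
  · have : (k + 1) % a = 0 := by
      rw [← Int.emod_add_emod, h, Int.emod_self]
    have h2 : (k % a).toNat + 1 = a := by omega
    rw [this, h2, ht]
    simp

/-- The `lattice a b c`-periodic point whose row `0 ≤ n < c` is generated by `t n`. -/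
noncomputable def periodicPoint (a b c : ℕ) (ha : 1 ≤ a) (t : ℤ → UnitAddCircle)
    (ht : ∀ n, 2 ^ a • t n = t n) : principalSystem xSubTwo :=
  ⟨fun k => 2 ^ (((k.1 - k.2 / c * b) % a).toNat) • t (k.2 % c),
    mem_principalSystem_xSubTwo.2 fun m n => by
      have := two_pow_emod_nsmul_add_one ha (ht (n % c)) (m - n / c * b)
      rw [← this]
      simp only
      congr 4
      ring⟩

theorem periodicPoint_apply {a b c : ℕ} (ha : 1 ≤ a) {t : ℤ → UnitAddCircle}
    (ht : ∀ n, 2 ^ a • t n = t n) (m n : ℤ) :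
    (periodicPoint a b c ha t ht).1 (m, n) =
      2 ^ (((m - n / c * b) % a).toNat) • t (n % c) := rfl

theorem periodicPoint_fixed {a b c : ℕ} (ha : 1 ≤ a) (hc : 1 ≤ c) {t : ℤ → UnitAddCircle}
    (ht : ∀ n, 2 ^ a • t n = t n) :
    ∀ l ∈ lattice a b c, l +ᵥ periodicPoint a b c ha t ht = periodicPoint a b c ha t ht := by
  rw [fixed_lattice_iff]
  constructor
  · intro m n
    rw [periodicPoint_apply, periodicPoint_apply]
    congr 3
    rw [add_sub_right_comm, Int.add_emod_right]
  · intro m n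
    have hc' : (c : ℤ) ≠ 0 := by positivity
    rw [periodicPoint_apply, periodicPoint_apply, Int.add_emod_right,
      Int.add_ediv_of_dvd_right dvd_rfl, Int.ediv_self hc']
    congr 4
    ring

/-- Translating by multiples of `(b, c)` and then of `(a, 0)` brings any position into the
fundamental rectangle, and doubling from column `0` gives the value there. -/
theorem apply_of_fixed {a b c : ℕ} (ha : 1 ≤ a) {x : principalSystem xSubTwo}
    (hx : ∀ l ∈ lattice a b c, l +ᵥ x = x) (m n : ℤ) :
    x.1 (m, n) = 2 ^ (((m - n / c * b) % a).toNat) • x.1 (0, n % c) := by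
  obtain ⟨h1, h2⟩ := fixed_lattice_iff.1 hx
  have h1' : ∀ (q : ℤ) (m n : ℤ), x.1 (m + q * a, n) = x.1 (m, n) := by
    intro q
    induction q with
    | zero => simp
    | succ i ih => intro m n; rw [add_mul, one_mul, ← add_assoc, h1, ih]
    | pred i ih => intro m n; rw [sub_mul, one_mul, ← h1, ← add_sub_assoc, sub_add_cancel, ih]
  have h2' : ∀ (q : ℤ) (m n : ℤ), x.1 (m + q * b, n + q * c) = x.1 (m, n) := by
    intro q
    induction q with
    | zero => simp
    | succ i ih =>
      intro m n; rw [add_mul, one_mul, ← add_assoc, add_mul, one_mul, ← add_assoc, h2, ih]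
    | pred i ih =>
      intro m n
      rw [sub_mul, one_mul, sub_mul, one_mul, ← h2, ← add_sub_assoc, sub_add_cancel,
        ← add_sub_assoc, sub_add_cancel, ih]
  have e1 := h2' (n / c) (m - n / c * b) (n % c)
  have e2 := h1' ((m - n / c * b) / a) ((m - n / c * b) % a) (n % c)
  rw [sub_add_cancel, Int.emod_add_ediv_mul] at e1
  rw [Int.emod_add_ediv_mul] at e2
  have ha' : (0 : ℤ) < a := by exact_mod_cast ha
  have e3 := principalSystem_apply_add x 0 (n % c) ((m - n / c * b) % a).toNat
  rw [Int.toNat_of_nonneg (Int.emod_nonneg _ ha'.ne'), zero_add] at e3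
  rw [e1, e2, e3]

theorem two_pow_nsmul_of_fixed {a b c : ℕ} {x : principalSystem xSubTwo}
    (hx : ∀ l ∈ lattice a b c, l +ᵥ x = x) (m n : ℤ) :
    2 ^ a • x.1 (m, n) = x.1 (m, n) := by
  rw [← principalSystem_apply_add, (fixed_lattice_iff.1 hx).1]

/-- Points fixed by `lattice a b c` are given by one `(2 ^ a - 1)`-torsion point per row. -/
noncomputable def fixedEquiv (a b c : ℕ) (ha : 1 ≤ a) (hc : 1 ≤ c) :
    {x : principalSystem xSubTwo | ∀ l ∈ lattice a b c, l +ᵥ x = x} ≃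
      (Fin c → {u : UnitAddCircle // (2 ^ a - 1) • u = 0}) where
  toFun x j := ⟨x.1.1 (0, ((j : ℕ) : ℤ)),
    two_pow_nsmul_eq_self.1 (two_pow_nsmul_of_fixed x.2 0 _)⟩
  invFun t := ⟨periodicPoint a b c ha
    -- Only `0 ≤ n < c` is ever used, where `n.toNat % c` equals `n`; the remainder merely supplies
    -- an index in `Fin c`.
    (fun n => t ⟨n.toNat % c, Nat.mod_lt _ hc⟩)
    (fun n => two_pow_nsmul_eq_self.2 (t ⟨n.toNat % c, Nat.mod_lt _ hc⟩).2), periodicPoint_fixed ha hc _⟩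
  left_inv x := by
    refine Subtype.ext (Subtype.ext (funext fun ⟨m, n⟩ => ?_))
    have hc' : (0 : ℤ) < c := by exact_mod_cast hc
    have e1 := Int.emod_nonneg n hc'.ne'
    have e2 := Int.emod_lt_of_pos n hc'
    rw [apply_of_fixed ha x.2 m n, periodicPoint_apply]
    simp only
    rw [Nat.mod_eq_of_lt (by omega), Int.toNat_of_nonneg e1]
  right_inv t := by
    funext j
    refine Subtype.ext ?_
    have hj : ((j : ℕ) : ℤ) < c := by exact_mod_cast j.2
    simp only [periodicPoint_apply, Int.ediv_eq_zero_of_lt (Int.natCast_nonneg j) hj,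
      Int.emod_eq_of_lt (Int.natCast_nonneg j) hj]
    simp [Nat.mod_eq_of_lt j.2]

theorem periodicCount_lattice {a c : ℕ} (b : ℕ) (ha : 1 ≤ a) (hc : 1 ≤ c) :
    periodicCount (principalSystem xSubTwo) (lattice a b c) = (((2 ^ a - 1) ^ c : ℕ) : ℕ∞) := by
  have hpos : 0 < 2 ^ a - 1 := by
    have := Nat.one_lt_two_pow (n := a) (by omega)
    omega
  have : Finite {u : UnitAddCircle // (2 ^ a - 1) • u = 0} :=
    Nat.finite_of_card_ne_zero (by rw [natCard_nsmul_eq_zero hpos]; exact hpos.ne')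
  rw [periodicCount, Set.encard, ENat.card_congr (fixedEquiv a b c ha hc),
    ENat.card_eq_coe_natCard, Nat.card_fun, natCard_nsmul_eq_zero hpos]
  simp

theorem two_pow_sub_one_pow_ne_zero {a : ℕ} (c : ℕ) (ha : 1 ≤ a) :
    (2 ^ a - 1) ^ c ≠ 0 := by
  have := Nat.one_lt_two_pow (n := a) (by omega)
  exact pow_ne_zero _ (by omega)

/-! ### Points with exact stabilizer `lattice a b 1`. -/

theorem eq_zero_of_two_pow_nsmul_eq {a k : ℕ} {t : UnitAddCircle}
    (ht : 2 ^ a • t = t) (h : ∀ m ∈ Finset.Icc 1 (a / 2), 2 ^ m • t ≠ t)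
    (hka : k < a) (hk : 2 ^ k • t = t) : k = 0 := by
  by_contra hk0
  have hit : ∀ n, Function.IsPeriodicPt (fun u : UnitAddCircle => 2 • u) n t ↔ 2 ^ n • t = t := by
    intro n
    rw [Function.IsPeriodicPt, Function.IsFixedPt, smul_iterate]
  -- The gcd of two periods of `t` under doubling is a period; as a proper divisor of `a` it is at
  -- most `a / 2`.
  have hg := (hit _).1 (((hit k).2 hk).gcd ((hit a).2 ht))
  have hpos : 0 < k.gcd a := Nat.gcd_pos_of_pos_left _ (by omega)
  have hle : k.gcd a ≤ k := Nat.gcd_le_left _ (by omega)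
  obtain ⟨q, hq⟩ := Nat.gcd_dvd_right k a
  refine h _ (Finset.mem_Icc.2 ⟨hpos, ?_⟩) hg
  have hq2 : 2 ≤ q := by
    by_contra hlt
    have : q ≤ 1 := by omega
    have : k.gcd a * q ≤ k.gcd a * 1 := Nat.mul_le_mul_left _ this
    omega
  have := Nat.mul_le_mul_left (k.gcd a) hq2
  omega

theorem card_exact_period {a : ℕ} (ha : 1 ≤ a) :
    ∃ S : Finset UnitAddCircle, 2 ^ a ≤ 4 * S.card ∧ ∀ t ∈ S, 2 ^ a • t = t ∧
      ∀ m ∈ Finset.Icc 1 (a / 2), 2 ^ m • t ≠ t := by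
  classical
  have htor : ∀ m : ℕ, 1 ≤ m → ∃ T : Finset UnitAddCircle, T.card = 2 ^ m - 1 ∧
      ∀ t, t ∈ T ↔ 2 ^ m • t = t := by
    intro m hm
    have hpos : 0 < 2 ^ m - 1 := by
      have := Nat.one_lt_two_pow (n := m) (by omega)
      omega
    refine ⟨(AddCircle.finite_torsion (1 : ℝ) hpos).toFinset, ?_, fun t => ?_⟩
    · rw [← Set.ncard_eq_toFinset_card _ (AddCircle.finite_torsion (1 : ℝ) hpos)]
      exact natCard_nsmul_eq_zero hpos
    · rw [two_pow_nsmul_eq_self]; simp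
  choose! T hT hmem using htor
  refine ⟨T a \ (Finset.Icc 1 (a / 2)).biUnion T, ?_, fun t ht => ?_⟩
  · have h1 : ((Finset.Icc 1 (a / 2)).biUnion T).card ≤ ∑ m ∈ Finset.Icc 1 (a / 2), 2 ^ m := by
      refine Finset.card_biUnion_le.trans (Finset.sum_le_sum fun m hm => ?_)
      rw [hT m (Finset.mem_Icc.1 hm).1]
      exact Nat.sub_le _ _
    have h2 : ∀ h : ℕ, ∑ m ∈ Finset.Icc 1 h, 2 ^ m + 2 = 2 * 2 ^ h := by
      intro h
      induction h with
      | zero => simp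
      | succ h ih =>
        rw [Finset.sum_Icc_succ_top (by omega), pow_succ]
        omega
    have h3 := Finset.le_card_sdiff ((Finset.Icc 1 (a / 2)).biUnion T) (T a)
    rw [hT a ha] at h3
    have h4 := h2 (a / 2)
    -- With `s = 2 ^ (a / 2) ≥ 2` and `s ^ 2 ≤ 2 ^ a`, this is `(3 * s - 2) * (s - 2) ≥ 0`.
    have h5 : 8 * 2 ^ (a / 2) ≤ 3 * 2 ^ a + 4 := by
      rcases Nat.lt_or_ge a 2 with h | h
      · have : a = 1 := by omega
        subst this; norm_num
      · have h6 : 2 ^ (a / 2) * 2 ^ (a / 2) ≤ 2 ^ a := by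
          rw [← pow_add]; exact Nat.pow_le_pow_right (by norm_num) (by omega)
        have h7 : 2 ^ 1 ≤ 2 ^ (a / 2) := Nat.pow_le_pow_right (by norm_num) (by omega)
        nlinarith
    omega
  · simp only [Finset.mem_sdiff, Finset.mem_biUnion, not_exists, not_and] at ht
    exact ⟨(hmem a ha t).1 ht.1, fun m hm h => ht.2 m hm ((hmem m (Finset.mem_Icc.1 hm).1 t).2 h)⟩

theorem two_pow_le_encard_stabilizer {a : ℕ} (b : ℕ) (ha : 1 ≤ a) :
    ((2 ^ a : ℕ) : ℕ∞) ≤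
      4 * {x : principalSystem xSubTwo | AddAction.stabilizer (ℤ × ℤ) x = lattice a b 1}.encard := by
  obtain ⟨S, hS, hex⟩ := card_exact_period ha
  have hle : (S : Set UnitAddCircle).encard ≤
      {x : principalSystem xSubTwo | AddAction.stabilizer (ℤ × ℤ) x = lattice a b 1}.encard := by
    have key : ∀ t ∈ S, ∃ x : principalSystem xSubTwo,
        AddAction.stabilizer (ℤ × ℤ) x = lattice a b 1 ∧ x.1 (0, 0) = t := by
      intro t ht
      have hx := periodicPoint_fixed (b := b) (c := 1) ha le_rfl (t := fun _ => t)
        (fun _ => (hex t ht).1)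
      have happ := periodicPoint_apply (b := b) (c := 1) ha (t := fun _ => t)
        (fun _ => (hex t ht).1)
      set x := periodicPoint a b 1 ha (fun _ => t) (fun _ => (hex t ht).1)
      refine ⟨x, le_antisymm ?_ hx, by simp [happ]⟩
      rintro ⟨m, n⟩ hmn
      have h0 := congrArg (fun y : principalSystem xSubTwo => y.1 (0, 0))
        (AddAction.mem_stabilizer_iff.1 hmn)
      simp only [shift_apply, Prod.mk_add_mk, add_zero, happ] at h0
      have ha' : (0 : ℤ) < a := by exact_mod_cast ha
      have e1 := Int.emod_nonneg (m - n * b) ha'.ne'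
      have e2 := Int.emod_lt_of_pos (m - n * b) ha'
      have := eq_zero_of_two_pow_nsmul_eq (k := ((m - n * b) % a).toNat) (hex t ht).1
        (hex t ht).2 (by omega) (by simpa using h0)
      obtain ⟨i, hi⟩ := Int.dvd_of_emod_eq_zero (show (m - n * b) % a = 0 by omega)
      exact mem_lattice.2 ⟨i, n, by simp only; linarith, by simp⟩
    -- The map is injective because `t` is recovered as the entry at the origin.
    choose! f hf using key
    refine Set.encard_le_encard_of_injOn (f := f) (fun t ht => (hf t ht).1) ?_
    intro t ht u hu h
    rw [← (hf t ht).2, ← (hf u hu).2, h]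
  calc ((2 ^ a : ℕ) : ℕ∞) ≤ ((4 * S.card : ℕ) : ℕ∞) := by exact_mod_cast hS
    _ = 4 * (S : Set UnitAddCircle).encard := by rw [Set.encard_coe_eq_coe_finsetCard]; simp
    _ ≤ _ := by gcongr

/-! ### The upper growth rate. -/

theorem ennreal_log_natCast {n : ℕ} (hn : n ≠ 0) :
    ENNReal.log (((n : ℕ∞) : ℝ≥0∞)) = ((Real.log n : ℝ) : EReal) := by
  rw [ENat.toENNReal_coe, ENNReal.log_pos_real (by exact_mod_cast hn) (ENNReal.natCast_ne_top n),
    ENNReal.toReal_natCast]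

theorem log_periodicCount_div_index {a c : ℕ} (b : ℕ) (ha : 1 ≤ a) (hc : 1 ≤ c) :
    ENNReal.log (periodicCount (principalSystem xSubTwo) (lattice a b c) : ℝ≥0∞) /
      (((lattice a b c).index : ℕ) : EReal) = ((Real.log (2 ^ a - 1) / a : ℝ) : EReal) := by
  rw [periodicCount_lattice b ha hc, ennreal_log_natCast (two_pow_sub_one_pow_ne_zero c ha),
    index_lattice b ha hc, ← EReal.coe_natCast, ← EReal.coe_div]
  congr 1
  have h1 : (a : ℝ) ≠ 0 := by positivity
  have h2 : (c : ℝ) ≠ 0 := by positivity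
  rw [Nat.cast_pow, Real.log_pow, Nat.cast_sub Nat.one_le_two_pow]
  push_cast
  field_simp

theorem log_two_pow_sub_one_div_le {a : ℕ} (ha : 1 ≤ a) :
    Real.log (2 ^ a - 1) / a ≤ Real.log 2 := by
  have h1 : (0 : ℝ) < a := by positivity
  have h2 : (2 : ℝ) ≤ 2 ^ a := le_self_pow₀ (by norm_num) (by omega)
  rw [div_le_iff₀ h1, mul_comm, ← Real.log_pow]
  exact Real.log_le_log (by linarith) (by linarith)

theorem le_log_two_pow_sub_one_div {a : ℕ} (ha : 1 ≤ a) :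
    Real.log 2 - Real.log 2 / a ≤ Real.log (2 ^ a - 1) / a := by
  obtain ⟨a, rfl⟩ := Nat.exists_eq_add_of_le' ha
  have h1 : (0 : ℝ) < ((a + 1 : ℕ) : ℝ) := by positivity
  have h2 : (1 : ℝ) ≤ 2 ^ a := one_le_pow₀ (by norm_num)
  rw [le_div_iff₀ h1, sub_mul, div_mul_cancel₀ _ h1.ne']
  calc _ = Real.log (2 ^ a) := by rw [Real.log_pow]; push_cast; ring
    _ ≤ _ := Real.log_le_log (by linarith) (by rw [pow_succ]; linarith)

theorem upperGrowthRate_xSubTwo :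
    upperGrowthRate (ℤ × ℤ) (principalSystem xSubTwo) = ((Real.log 2 : ℝ) : EReal) := by
  apply le_antisymm
  -- Every single term is at most `log 2`, so the supremum with `N = 0` already suffices.
  · refine (iInf_le _ 0).trans (iSup_le ?_)
    rintro ⟨L, hL, -⟩
    obtain ⟨a, b, c, ha, hc, -, rfl⟩ := exists_eq_lattice L hL
    rw [log_periodicCount_div_index b ha hc]
    exact EReal.coe_le_coe_iff.2 (log_two_pow_sub_one_div_le ha)
  · refine le_iInf fun N => ?_
    have hlim : Tendsto (fun a : ℕ => ((Real.log 2 - Real.log 2 / a : ℝ) : EReal)) atTop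
        (𝓝 ((Real.log 2 : ℝ) : EReal)) := by
      refine (continuous_coe_real_ereal.tendsto _).comp ?_
      simpa using (tendsto_const_div_atTop_nhds_zero_nat (Real.log 2)).const_sub (Real.log 2)
    refine le_of_tendsto hlim ?_
    filter_upwards [eventually_ge_atTop (max 1 N)] with a ha
    have ha1 : 1 ≤ a := (le_max_left _ _).trans ha
    have hidx := index_lattice 0 ha1 le_rfl
    refine le_trans ?_ (le_iSup _ ⟨lattice a 0 1, ⟨by rw [hidx]; omega⟩, by
      rw [hidx, mul_one]; exact (le_max_right _ _).trans ha⟩)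
    rw [log_periodicCount_div_index 0 ha1 le_rfl]
    exact EReal.coe_le_coe_iff.2 (le_log_two_pow_sub_one_div ha1)

/-! ### Linear growth of the weighted orbit sum. -/

theorem exp_log_two_mul (n : ℕ) :
    EReal.exp (((Real.log 2 : ℝ) : EReal) * (n : EReal)) = 2 ^ n := by
  have h : ((Real.log 2 : ℝ) : EReal) = ENNReal.log 2 := by
    rw [ENNReal.log_pos_real (by norm_num) (by norm_num)]; simp
  rw [h, mul_comm, EReal.exp_nmul, ENNReal.exp_log]

theorem weightedOrbitSum_xSubTwo (N : ℕ) :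
    weightedOrbitSum (ℤ × ℤ) (principalSystem xSubTwo) N =
      ∑' L : {L : AddSubgroup (ℤ × ℤ) // L.FiniteIndex ∧ L.index ≤ N},
        orbitCount (principalSystem xSubTwo) L.1 / 2 ^ L.1.index := by
  simp only [weightedOrbitSum, upperGrowthRate_xSubTwo, exp_log_two_mul]

theorem orbitCount_lattice_div_le {a c : ℕ} (b : ℕ) (ha : 1 ≤ a) (hc : 1 ≤ c) :
    orbitCount (principalSystem xSubTwo) (lattice a b c) / 2 ^ (lattice a b c).index ≤
      ENNReal.ofReal (1 / (a * c)) := by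
  have h1 : {x : principalSystem xSubTwo |
      AddAction.stabilizer (ℤ × ℤ) x = lattice a b c}.encard ≤ ((2 ^ (a * c) : ℕ) : ℕ∞) := by
    refine le_trans (Set.encard_le_encard fun x hx => ?_)
      -- A point whose stabilizer is the lattice is in particular fixed by it.
      ((periodicCount_lattice b ha hc).le.trans ?_)
    · intro l hl
      rw [← (show AddAction.stabilizer (ℤ × ℤ) x = lattice a b c from hx)] at hl
      exact hl
    · rw [pow_mul]
      exact_mod_cast Nat.pow_le_pow_left (Nat.sub_le _ _) _
  have h2 : ({x : principalSystem xSubTwo |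
      AddAction.stabilizer (ℤ × ℤ) x = lattice a b c}.encard : ℝ≥0∞) ≤ 2 ^ (a * c) := by
    refine (ENat.toENNReal_le.2 h1).trans ?_
    simp
  have h3 : (0 : ℝ) < a * c := by positivity
  rw [orbitCount, index_lattice b ha hc]
  refine ENNReal.div_le_of_le_mul (ENNReal.div_le_of_le_mul (h2.trans (le_of_eq ?_)))
  rw [mul_right_comm, ← ENNReal.ofReal_natCast, ← ENNReal.ofReal_mul (by positivity)]
  push_cast
  rw [one_div_mul_cancel h3.ne']
  simp

theorem le_orbitCount_lattice_div {a : ℕ} (b : ℕ) (ha : 1 ≤ a) :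
    ENNReal.ofReal (1 / (4 * a)) ≤
      orbitCount (principalSystem xSubTwo) (lattice a b 1) / 2 ^ (lattice a b 1).index := by
  have h := two_pow_le_encard_stabilizer b ha
  have h3 : (0 : ℝ) < a := by positivity
  rw [orbitCount, index_lattice b ha le_rfl, mul_one,
    ENNReal.le_div_iff_mul_le (by simp) (by simp), ENNReal.le_div_iff_mul_le (by simp; omega)
      (by simp)]
  have e : ENNReal.ofReal (1 / (4 * a)) * 2 ^ a * a = ENNReal.ofReal (2 ^ a / 4) := by
    have e2 : (2 : ℝ≥0∞) ^ a = ENNReal.ofReal (2 ^ a) := by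
      rw [ENNReal.ofReal_pow (by norm_num)]; simp
    rw [e2, ← ENNReal.ofReal_natCast a, ← ENNReal.ofReal_mul (by positivity),
      ← ENNReal.ofReal_mul (by positivity)]
    congr 1
    field_simp
  rw [e]
  revert h
  generalize {x : principalSystem xSubTwo |
    AddAction.stabilizer (ℤ × ℤ) x = lattice a b 1}.encard = E
  intro h
  induction E using ENat.recTopCoe with
  | top => simp
  | coe k =>
    have h' : 2 ^ a ≤ 4 * k := by exact_mod_cast h
    have h'' : (2 : ℝ) ^ a ≤ 4 * k := by exact_mod_cast h'
    rw [ENat.toENNReal_coe, ← ENNReal.ofReal_natCast]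
    exact ENNReal.ofReal_le_ofReal (by linarith)

theorem lattice_one_injective {a b a' b' : ℕ} (hb : b < a) (hb' : b' < a')
    (h : lattice a b 1 = lattice a' b' 1) : a = a' ∧ b = b' := by
  have haa : a = a' := by
    have := index_lattice b (a := a) (by omega) le_rfl
    rw [h, index_lattice b' (by omega) le_rfl] at this
    omega
  subst haa
  refine ⟨rfl, ?_⟩
  have hm : ((b : ℤ), (1 : ℤ)) ∈ lattice a b' 1 := by
    rw [← h]; exact mem_lattice.2 ⟨0, 1, by simp, by simp⟩
  obtain ⟨i, j, h1, h2⟩ := mem_lattice.1 hm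
  simp only [Nat.cast_one, mul_one] at h1 h2
  subst h2
  have : (b : ℤ) % a = (b' : ℤ) % a := by rw [h1]; simp
  rw [Int.emod_eq_of_lt (by positivity) (by exact_mod_cast hb),
    Int.emod_eq_of_lt (by positivity) (by exact_mod_cast hb')] at this
  exact_mod_cast this

/-- The lattices with `c = 1` and `b < a ≤ N` are pairwise distinct, and the `a` choices of `b`
contribute at least `1 / (4 * a)` each. -/
theorem le_weightedOrbitSum (N : ℕ) :
    ENNReal.ofReal (1 / 4 * N) ≤ weightedOrbitSum (ℤ × ℤ) (principalSystem xSubTwo) N := by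
  rw [weightedOrbitSum_xSubTwo]
  let T : Finset (Σ _ : ℕ, ℕ) := (Finset.Icc 1 N).sigma fun a => Finset.range a
  have hT : ∀ p : T, (1 ≤ p.1.1 ∧ p.1.1 ≤ N) ∧ p.1.2 < p.1.1 := fun p => by
    have := p.2
    simpa only [T, Finset.mem_sigma, Finset.mem_Icc, Finset.mem_range] using this
  let ψ : T → {L : AddSubgroup (ℤ × ℤ) // L.FiniteIndex ∧ L.index ≤ N} := fun p =>
    ⟨lattice p.1.1 p.1.2 1, ⟨by rw [index_lattice _ (hT p).1.1 le_rfl]; have := (hT p).1.1; omega⟩,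
      by rw [index_lattice _ (hT p).1.1 le_rfl, mul_one]; exact (hT p).1.2⟩
  have hψ : Function.Injective ψ := by
    intro p q h
    obtain ⟨h1, h2⟩ := lattice_one_injective (hT p).2 (hT q).2 (Subtype.ext_iff.1 h)
    exact Subtype.ext (Sigma.ext h1 (heq_of_eq h2))
  refine le_trans ?_ (ENNReal.tsum_comp_le_tsum_of_injective hψ _)
  refine le_trans ?_ (ENNReal.tsum_le_tsum fun p => le_orbitCount_lattice_div p.1.2 (hT p).1.1)
  rw [Finset.tsum_subtype T (fun p => ENNReal.ofReal (1 / (4 * p.1))),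
    ← ENNReal.ofReal_sum_of_nonneg (fun p _ => by positivity)]
  refine ENNReal.ofReal_le_ofReal (le_of_eq ?_)
  rw [Finset.sum_sigma, Finset.sum_congr rfl (g := fun _ => (1 / 4 : ℝ))]
  · simp [mul_comm]
  · intro a ha
    have : (a : ℝ) ≠ 0 := by have := (Finset.mem_Icc.1 ha).1; positivity
    simp only [Finset.sum_const, Finset.card_range, nsmul_eq_mul]
    field_simp

theorem weightedOrbitSum_le (N : ℕ) :
    weightedOrbitSum (ℤ × ℤ) (principalSystem xSubTwo) N ≤
      ENNReal.ofReal ((∑' c : ℕ, 1 / (c : ℝ) ^ 2) * N) := by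
  rw [weightedOrbitSum_xSubTwo]
  let T : Finset (Σ _ : ℕ, Σ _ : ℕ, ℕ) :=
    (Finset.Icc 1 N).sigma fun c => (Finset.Icc 1 (N / c)).sigma fun a => Finset.range a
  have key : ∀ L : {L : AddSubgroup (ℤ × ℤ) // L.FiniteIndex ∧ L.index ≤ N},
      ∃ p : T, 1 ≤ p.1.2.1 ∧ 1 ≤ p.1.1 ∧ L.1 = lattice p.1.2.1 p.1.2.2 p.1.1 := by
    rintro ⟨L, hL, hN⟩
    obtain ⟨a, b, c, ha, hc, hb, rfl⟩ := exists_eq_lattice L hL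
    rw [index_lattice b ha hc] at hN
    refine ⟨⟨⟨c, a, b⟩, ?_⟩, ha, hc, rfl⟩
    simp only [T, Finset.mem_sigma, Finset.mem_Icc, Finset.mem_range]
    exact ⟨⟨hc, (Nat.le_mul_of_pos_left c ha).trans hN⟩, ⟨ha, (Nat.le_div_iff_mul_le hc).2 hN⟩, hb⟩
  choose φ hφ using key
  have hinj : Function.Injective φ := fun L L' h => Subtype.ext (by
    rw [(hφ L).2.2, (hφ L').2.2, h])
  let w : T → ℝ≥0∞ := fun p => ENNReal.ofReal (1 / (p.1.2.1 * p.1.1))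
  have hle : ∀ L : {L : AddSubgroup (ℤ × ℤ) // L.FiniteIndex ∧ L.index ≤ N},
      orbitCount (principalSystem xSubTwo) L.1 / 2 ^ L.1.index ≤ w (φ L) :=
      fun L => by
    rw [(hφ L).2.2]
    exact orbitCount_lattice_div_le _ (hφ L).1 (hφ L).2.1
  refine (ENNReal.tsum_le_tsum hle).trans ((ENNReal.tsum_comp_le_tsum_of_injective hinj w).trans ?_)
  rw [Finset.tsum_subtype T (fun p => ENNReal.ofReal (1 / (p.2.1 * p.1))),
    ← ENNReal.ofReal_sum_of_nonneg (fun p _ => by positivity)]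
  refine ENNReal.ofReal_le_ofReal ?_
  rw [Finset.sum_sigma]
  have hsum : Summable fun c : ℕ => 1 / (c : ℝ) ^ 2 := Real.summable_one_div_nat_pow.2 (by norm_num)
  -- For fixed `c`, each of the `N / c` values of `a` contributes `a * (1 / (a * c)) = 1 / c`.
  calc _ ≤ ∑ c ∈ Finset.Icc 1 N, 1 / (c : ℝ) ^ 2 * (N : ℝ) := Finset.sum_le_sum fun c hc => ?_
    _ = (∑ c ∈ Finset.Icc 1 N, 1 / (c : ℝ) ^ 2) * (N : ℝ) := by rw [Finset.sum_mul]
    _ ≤ _ := by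
      gcongr
      exact hsum.sum_le_tsum _ (fun c _ => by positivity)
  have hc0 : (0 : ℝ) < c := by have := (Finset.mem_Icc.1 hc).1; positivity
  rw [Finset.sum_sigma, Finset.sum_congr rfl (g := fun _ => (1 / c : ℝ))]
  · have h1 : ((N / c : ℕ) : ℝ) ≤ N / c := Nat.cast_div_le
    calc _ = ((N / c : ℕ) : ℝ) * (1 / c : ℝ) := by simp
      _ ≤ (N : ℝ) / c * (1 / c : ℝ) := by gcongr
      _ = _ := by field_simp
  · intro a ha
    have : (a : ℝ) ≠ 0 := by have := (Finset.mem_Icc.1 ha).1; positivity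
    simp only [Finset.sum_const, Finset.card_range, nsmul_eq_mul]
    field_simp

theorem weightedOrbitSum_linear_growth :
    ∃ C₁₁ C₁₂ : ℝ, 0 < C₁₁ ∧ 0 < C₁₂ ∧ ∀ᶠ N : ℕ in atTop,
      ENNReal.ofReal (C₁₁ * N) ≤ weightedOrbitSum (ℤ × ℤ) (principalSystem xSubTwo) N ∧
      weightedOrbitSum (ℤ × ℤ) (principalSystem xSubTwo) N ≤ ENNReal.ofReal (C₁₂ * N) := by
  refine ⟨1 / 4, ∑' c : ℕ, 1 / (c : ℝ) ^ 2, by norm_num, ?_,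
    Eventually.of_forall fun N => ⟨le_weightedOrbitSum N, weightedOrbitSum_le N⟩⟩
  exact (Real.summable_one_div_nat_pow.2 (by norm_num)).tsum_pos (fun c => by positivity) 1
    (by norm_num)

/-! ### Haar means over closed subgroups of the torus. -/

theorem logAbs_xSubTwo (p : Torus) :
    logAbs xSubTwo p = Real.log ‖(p.1.toCircle : ℂ) - 2‖ := by
  rw [logAbs, xSubTwo_support, Finset.sum_pair (by simp), xSubTwo_coeff_one, xSubTwo_coeff_zero]
  simp [sub_eq_add_neg]

/-- The power series of `log |z - 2|` on the unit circle. -/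
theorem hasSum_log_norm_sub_two (z : Circle) :
    HasSum (fun n : ℕ => (1 / 2 : ℝ) ^ n / n * ((z ^ n : Circle) : ℂ).re)
      (Real.log 2 - Real.log ‖(z : ℂ) - 2‖) := by
  have hz : ‖(z : ℂ) / 2‖ < 1 := by rw [norm_div, Circle.norm_coe]; norm_num
  have h := Complex.hasSum_re (Complex.hasSum_taylorSeries_neg_log hz)
  have hne : ‖1 - (z : ℂ) / 2‖ ≠ 0 := by
    rw [norm_ne_zero_iff, sub_ne_zero]
    intro h1
    rw [← h1] at hz
    simp at hz
  have e : Real.log 2 - Real.log ‖(z : ℂ) - 2‖ = (-Complex.log (1 - (z : ℂ) / 2)).re := by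
    have : ‖(z : ℂ) - 2‖ = 2 * ‖1 - (z : ℂ) / 2‖ := by
      rw [norm_sub_rev, show (2 : ℂ) - z = 2 * (1 - z / 2) by ring, norm_mul]
      simp
    rw [this, Real.log_mul two_ne_zero hne, Complex.neg_re, Complex.log_re]
    ring
  rw [e]
  refine h.congr_fun fun n => ?_
  have : ((z : ℂ) / 2) ^ n / n = (((1 / 2 : ℝ) ^ n / n : ℝ) : ℂ) * (z : ℂ) ^ n := by
    push_cast
    rw [div_pow, div_pow]
    ring
  rw [this, Complex.re_ofReal_mul, Circle.coe_pow]

section Haar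

variable (K : ClosedAddSubgroup Torus)

/-- The Haar probability measure of a closed subgroup of the torus. -/
noncomputable abbrev haarProb : Measure K.toAddSubgroup :=
  Measure.addHaarMeasure (⊤ : TopologicalSpace.PositiveCompacts K.toAddSubgroup)

instance isProbabilityMeasure_haarProb : IsProbabilityMeasure (haarProb K) :=
  ⟨by
    have h := Measure.addHaarMeasure_self
      (K₀ := (⊤ : TopologicalSpace.PositiveCompacts K.toAddSubgroup))
    simpa using h⟩

/-- The character `(s, t) ↦ exp (2 π i n s)` of a subgroup of the torus. -/
noncomputable def fstCharacter (n : ℕ) (p : K.toAddSubgroup) : ℂ :=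
  ((p.1.1.toCircle ^ n : Circle) : ℂ)

theorem continuous_fstCharacter (n : ℕ) : Continuous (fstCharacter K n) := by
  unfold fstCharacter
  fun_prop

theorem norm_fstCharacter (n : ℕ) (p : K.toAddSubgroup) : ‖fstCharacter K n p‖ = 1 :=
  Circle.norm_coe _

theorem fstCharacter_add (n : ℕ) (p q : K.toAddSubgroup) :
    fstCharacter K n (p + q) = fstCharacter K n p * fstCharacter K n q := by
  simp [fstCharacter, AddCircle.toCircle_add, mul_pow]

theorem fstCharacter_eq_one_iff (n : ℕ) (p : K.toAddSubgroup) :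
    fstCharacter K n p = 1 ↔ n • p.1.1 = 0 := by
  rw [fstCharacter, Circle.coe_eq_one, ← AddCircle.toCircle_nsmul, ← AddCircle.toCircle_zero,
    (AddCircle.injective_toCircle one_ne_zero).eq_iff]

open Classical in
theorem integral_fstCharacter (n : ℕ) :
    ∫ p, fstCharacter K n p ∂(haarProb K) = if ∀ p ∈ K, n • p.1 = 0 then 1 else 0 := by
  split_ifs with h
  · rw [integral_congr_ae (g := fun _ => (1 : ℂ))
      (Eventually.of_forall fun p => (fstCharacter_eq_one_iff K n p).2 (h p.1 p.2))]
    simp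
  · push Not at h
    obtain ⟨q, hq, hne⟩ := h
    -- Translation by `q` multiplies the integral by the character value at `q`, which is not `1`;
    -- so the integral vanishes.
    have h1 := integral_add_left_eq_self (μ := haarProb K) (fstCharacter K n) ⟨q, hq⟩
    simp only [fstCharacter_add, integral_const_mul] at h1
    have h2 : fstCharacter K n ⟨q, hq⟩ ≠ 1 := fun h => hne ((fstCharacter_eq_one_iff K n _).1 h)
    by_contra h0
    exact h2 (mul_right_cancel₀ h0 (by rw [h1, one_mul]))

open Classical in
-- Termwise integration, dominated by the geometric series, and orthogonality of characters. The
-- index `n = 0` always meets the condition but contributes `0`, since division by zero gives `0`.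
theorem hasSum_haarMean :
    HasSum (fun n : ℕ => if ∀ p ∈ K, n • p.1 = 0 then (1 / 2 : ℝ) ^ n / n else 0)
      (Real.log 2 - haarMean xSubTwo K) := by
  have hint : ∀ n, Integrable (fstCharacter K n) (haarProb K) := fun n =>
    Integrable.of_bound (continuous_fstCharacter K n).aestronglyMeasurable 1
      (Eventually.of_forall fun p => (norm_fstCharacter K n p).le)
  have hF : ∀ n : ℕ, ∫ p, (1 / 2 : ℝ) ^ n / n * (fstCharacter K n p).re ∂(haarProb K) =
      if ∀ p ∈ K, n • p.1 = 0 then (1 / 2 : ℝ) ^ n / n else 0 := by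
    intro n
    have h := integral_re (hint n)
    simp only [RCLike.re_eq_complex_re] at h
    rw [integral_const_mul, h, integral_fstCharacter]
    split_ifs <;> simp
  have hbound : ∀ (n : ℕ) (p : K.toAddSubgroup),
      ‖(1 / 2 : ℝ) ^ n / n * (fstCharacter K n p).re‖ ≤ (1 / 2 : ℝ) ^ n := by
    intro n p
    have h1 : |(fstCharacter K n p).re| ≤ 1 :=
      (Complex.abs_re_le_norm _).trans (norm_fstCharacter K n p).le
    have h2 : (1 / 2 : ℝ) ^ n / n ≤ (1 / 2 : ℝ) ^ n := by
      rcases Nat.eq_zero_or_pos n with rfl | hn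
      · simp
      · exact div_le_self (by positivity) (by exact_mod_cast hn)
    rw [norm_mul, Real.norm_of_nonneg (by positivity), Real.norm_eq_abs]
    calc _ ≤ (1 / 2 : ℝ) ^ n * 1 := by gcongr
      _ = _ := mul_one _
  have hgeom : Summable fun n : ℕ => (1 / 2 : ℝ) ^ n := summable_geometric_two
  have h := hasSum_integral_of_dominated_convergence (μ := haarProb K)
    (F := fun (n : ℕ) p => (1 / 2 : ℝ) ^ n / n * (fstCharacter K n p).re)
    (f := fun p => Real.log 2 - logAbs xSubTwo p.1) (fun n _ => (1 / 2 : ℝ) ^ n)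
    (fun n => ((Complex.continuous_re.comp (continuous_fstCharacter K n)).const_mul
      _).aestronglyMeasurable)
    (fun n => Eventually.of_forall (hbound n)) (Eventually.of_forall fun _ => hgeom)
    (integrable_const _)
    (Eventually.of_forall fun p => by
      rw [logAbs_xSubTwo]; exact hasSum_log_norm_sub_two p.1.1.toCircle)
  simp only [hF] at h
  have hlog : Integrable (fun p : K.toAddSubgroup => logAbs xSubTwo p.1) (haarProb K) := by
    simp only [logAbs_xSubTwo]
    have hne : ∀ p : K.toAddSubgroup, ‖((p.1.1.toCircle : Circle) : ℂ) - 2‖ ≠ 0 := by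
      intro p h0
      rw [norm_eq_zero, sub_eq_zero] at h0
      have := Circle.norm_coe p.1.1.toCircle
      rw [h0] at this
      norm_num at this
    have hc : Continuous fun p : K.toAddSubgroup =>
        Real.log ‖((p.1.1.toCircle : Circle) : ℂ) - 2‖ := by
      refine Continuous.log ?_ hne
      fun_prop
    exact hc.integrable_of_hasCompactSupport (HasCompactSupport.of_compactSpace _)
  rw [integral_sub (integrable_const _) hlog] at h
  simpa [haarMean] using h

theorem haarMean_le : haarMean xSubTwo K ≤ Real.log 2 := by
  classical
  have := (hasSum_haarMean K).nonneg (fun n => by split_ifs <;> positivity)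
  linarith

end Haar

theorem exists_nsmul_ne_zero {n : ℕ} (hn : n ≠ 0) : ∃ u : UnitAddCircle, n • u ≠ 0 := by
  refine ⟨((1 / (n + 1 : ℕ) : ℝ) : UnitAddCircle), fun h => ?_⟩
  rw [← addOrderOf_dvd_iff_nsmul_eq_zero, AddCircle.addOrderOf_period_div (Nat.succ_pos n)] at h
  exact absurd (Nat.le_of_dvd (Nat.pos_of_ne_zero hn) h) (by omega)

theorem haarMean_of_fst_surjective (K : ClosedAddSubgroup Torus)
    (hK : ∀ u : UnitAddCircle, ∃ v, (u, v) ∈ K) : haarMean xSubTwo K = Real.log 2 := by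
  classical
  have h := hasSum_haarMean K
  have h0 : (fun n : ℕ => if ∀ p ∈ K, n • p.1 = 0 then (1 / 2 : ℝ) ^ n / n else 0) =
      fun _ => 0 := by
    funext n
    rcases eq_or_ne n 0 with rfl | hn
    · simp
    · obtain ⟨u, hu⟩ := exists_nsmul_ne_zero hn
      obtain ⟨v, hv⟩ := hK u
      exact if_neg fun h => hu (h _ hv)
  rw [h0] at h
  linarith [h.unique hasSum_zero]

theorem haarMean_wholeTorus : haarMean xSubTwo wholeTorus = Real.log 2 :=
  haarMean_of_fst_surjective _ fun _ => ⟨0, trivial⟩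

theorem haarMean_J₂ (b : ℕ) {c : ℕ} (hc : 1 ≤ c) : haarMean xSubTwo (J₂ b c) = Real.log 2 :=
  haarMean_of_fst_surjective _ fun u => by
    induction u using QuotientAddGroup.induction_on with
    | H t => exact ⟨_, (mem_J₂ hc _).2 ⟨0, t, rfl⟩⟩

theorem haarMean_J₁ {a : ℕ} (ha : 1 ≤ a) :
    haarMean xSubTwo (J₁ a) = 1 / (a : ℝ) * Real.log (2 ^ a - 1) := by
  classical
  have h := hasSum_haarMean (J₁ a)
  have hiff : ∀ n : ℕ, (∀ p ∈ J₁ a, n • p.1 = 0) ↔ a ∣ n := by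
    intro n
    constructor
    · intro h
      have h1 := h ((((1 : ℤ) : ℝ) / a : ℝ), 0) ((mem_J₁ ha _).2 ⟨1, 0, rfl⟩)
      rw [← addOrderOf_dvd_iff_nsmul_eq_zero, Int.cast_one,
        AddCircle.addOrderOf_period_div (by omega)] at h1
      exact h1
    · rintro ⟨k, rfl⟩ p hp
      have : a • p.1 = 0 := hp
      rw [mul_nsmul, this, smul_zero]
  simp only [hiff] at h
  -- The positive multiples of `a` carry the whole sum, which becomes `1 / a` times the series of
  -- `-log (1 - x)` at `x = (1 / 2) ^ a`.
  have hinj : Function.Injective fun j : ℕ => a * (j + 1) := fun i j hij => by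
    have := Nat.eq_of_mul_eq_mul_left (by omega) hij
    omega
  rw [← hinj.hasSum_iff] at h
  · have ha0 : (a : ℝ) ≠ 0 := by positivity
    have hx : |(1 / 2 : ℝ) ^ a| < 1 := by
      rw [abs_of_pos (by positivity)]
      exact pow_lt_one₀ (by norm_num) (by norm_num) (by omega)
    have h' := (Real.hasSum_pow_div_log_of_abs_lt_one hx).mul_left (1 / (a : ℝ))
    have e := h.unique (h'.congr_fun fun j => by
      have : (j : ℝ) + 1 ≠ 0 := by positivity
      simp only [Function.comp, dvd_mul_right, if_true, pow_mul]
      push_cast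
      field_simp)
    have h2 : (1 : ℝ) < 2 ^ a := one_lt_pow₀ (by norm_num) (by omega)
    have h3 : (1 : ℝ) - (1 / 2) ^ a = (2 ^ a - 1) / 2 ^ a := by
      rw [div_pow, one_pow]
      field_simp
    rw [h3, Real.log_div (by linarith) (by positivity), Real.log_pow] at e
    have : haarMean xSubTwo (J₁ a) = Real.log 2 - 1 / (a : ℝ) *
        -(Real.log (2 ^ a - 1) - a * Real.log 2) := by linarith
    rw [this]
    field_simp
    ring
  · intro n hn
    split_ifs with hd
    · obtain ⟨k, rfl⟩ := hd
      rcases k with _ | k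
      · simp
      · exact absurd ⟨k, rfl⟩ hn
    · rfl

/-- A circle with `N` elements could not contain `N + 1` points of `(N + 1)`-torsion. -/
theorem infinite_unitAddCircle : Infinite UnitAddCircle := by
  by_contra h
  rw [not_infinite_iff_finite] at h
  have h1 := natCard_nsmul_eq_zero (Nat.succ_pos (Nat.card UnitAddCircle))
  have h2 := Finite.card_subtype_le
    (fun u : UnitAddCircle => (Nat.card UnitAddCircle).succ • u = 0)
  omega

theorem isLUB_haarMean :
    IsLUB {r : ℝ | ∃ K : ClosedAddSubgroup Torus,
      (K : Set Torus).Infinite ∧ r = haarMean xSubTwo K} (Real.log 2) := by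
  refine ⟨?_, fun r hr => hr ⟨wholeTorus, ?_, haarMean_wholeTorus.symm⟩⟩
  · rintro _ ⟨K, -, rfl⟩
    exact haarMean_le K
  · have := infinite_unitAddCircle
    exact Set.infinite_univ (α := Torus)

/-! ### Topological entropy. -/

/-- The point of the system with `x (-r, n) = θ n`. -/
noncomputable def rowPoint (r : ℤ) (θ : ℤ → ℝ) : principalSystem xSubTwo :=
  ⟨fun k => (((2 : ℝ) ^ (k.1 + r) * θ k.2 : ℝ) : UnitAddCircle),
    mem_principalSystem_xSubTwo.2 fun m n => by
      simp only
      rw [← AddCircle.coe_nsmul, add_right_comm, zpow_add_one₀ two_ne_zero, nsmul_eq_mul]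
      congr 1
      push_cast
      ring⟩

theorem rowPoint_apply (r : ℤ) (θ : ℤ → ℝ) (m n : ℤ) :
    (rowPoint r θ).1 (m, n) = (((2 : ℝ) ^ (m + r) * θ n : ℝ) : UnitAddCircle) := rfl

theorem norm_coe_unitAddCircle_le (x : ℝ) : ‖(x : UnitAddCircle)‖ ≤ |x| :=
  QuotientAddGroup.norm_mk_le_norm

theorem norm_half_odd {d : ℤ} (hd : Odd d) : ‖(((d : ℝ) / 2 : ℝ) : UnitAddCircle)‖ = 1 / 2 := by
  obtain ⟨k, rfl⟩ := hd
  have e : ((2 * k + 1 : ℤ) : ℝ) / 2 = k • (1 : ℝ) + 1 / 2 := by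
    push_cast
    rw [zsmul_eq_mul]
    ring
  have h0 : ((k • (1 : ℝ) : ℝ) : UnitAddCircle) = 0 := (AddCircle.coe_eq_zero_iff (1 : ℝ)).2 ⟨k, rfl⟩
  rw [e, AddCircle.coe_add, h0, zero_add]
  simpa using AddCircle.norm_half_period_eq (1 : ℝ)

/-- Doubling `n` times separates distinct points `j / 2 ^ n` of the circle. -/
theorem eq_zero_of_norm_lt_half {n : ℕ} {d : ℤ} (hd : |d| < 2 ^ n)
    (h : ∀ m < n, ‖(((2 : ℝ) ^ m * (d / 2 ^ n) : ℝ) : UnitAddCircle)‖ < 1 / 2) : d = 0 := by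
  have key : ∀ j ≤ n, (2 : ℤ) ^ j ∣ d := by
    intro j
    induction j with
    | zero => simp
    | succ j ih =>
      intro hj
      obtain ⟨e, rfl⟩ := ih (by omega)
      rcases Int.even_or_odd e with he | he
      · obtain ⟨q, rfl⟩ := he.two_dvd
        exact ⟨q, by ring⟩
      -- If `2 ^ j` is the exact power of `2` in `d`, then `n - 1 - j` doublings reach an odd
      -- multiple of `1 / 2`, at distance `1 / 2` from `0`.
      · have h1 := h (n - 1 - j) (by omega)
        have e1 : (2 : ℝ) ^ (n - 1 - j) * (((2 ^ j * e : ℤ) : ℝ) / 2 ^ n) = e / 2 := by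
          have : (2 : ℝ) ^ n = 2 ^ (n - 1 - j) * 2 ^ j * 2 := by
            rw [← pow_add, ← pow_succ]; congr 1; omega
          rw [this]
          push_cast
          field_simp
        rw [e1, norm_half_odd he] at h1
        exact absurd h1 (lt_irrefl _)
  exact Int.eq_zero_of_abs_lt_dvd (key n le_rfl) hd

theorem exists_window {U : Set (principalSystem xSubTwo × principalSystem xSubTwo)}
    (hU : U ∈ 𝓤 (principalSystem xSubTwo)) :
    ∃ r : ℕ, ∀ x y : principalSystem xSubTwo,
      (∀ m n : ℤ, |m| ≤ r → |n| ≤ r → dist (x.1 (m, n)) (y.1 (m, n)) < (1 / 2 : ℝ) ^ r) →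
      (x, y) ∈ U := by
  rw [uniformity_subtype, Pi.uniformity, ((HasBasis.iInf' fun i =>
    Metric.uniformity_basis_dist.comap _).comap _).mem_iff] at hU
  obtain ⟨⟨I, f⟩, ⟨hI, hf⟩, hsub⟩ := hU
  simp only at hI hf hsub
  have hev : ∀ᶠ r : ℕ in atTop, ∀ i ∈ I, (1 / 2 : ℝ) ^ r < f i ∧ |i.1| ≤ r ∧ |i.2| ≤ r := by
    rw [eventually_all_finite hI]
    intro i hi
    have h1 : Tendsto (fun r : ℕ => (1 / 2 : ℝ) ^ r) atTop (𝓝 0) :=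
      tendsto_pow_atTop_nhds_zero_of_lt_one (by norm_num) (by norm_num)
    filter_upwards [h1.eventually_lt_const (hf i hi), eventually_ge_atTop i.1.natAbs,
      eventually_ge_atTop i.2.natAbs] with r h1 h2 h3
    exact ⟨h1, abs_le.2 ⟨by omega, by omega⟩, abs_le.2 ⟨by omega, by omega⟩⟩
  obtain ⟨r, hr⟩ := hev.exists
  refine ⟨r, fun x y h => hsub ?_⟩
  simp only [Set.mem_preimage, Set.mem_iInter]
  intro i hi
  obtain ⟨h1, h2, h3⟩ := hr i hi
  exact (h i.1 i.2 h2 h3).trans h1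

theorem spanningNumber_le {U : Set (principalSystem xSubTwo × principalSystem xSubTwo)} {r : ℕ}
    (hr : ∀ x y : principalSystem xSubTwo,
      (∀ m n : ℤ, |m| ≤ r → |n| ≤ r → dist (x.1 (m, n)) (y.1 (m, n)) < (1 / 2 : ℝ) ^ r) →
      (x, y) ∈ U) (n : ℕ) :
    spanningNumber (principalSystem xSubTwo) U n ≤
      ((2 ^ ((n + 3 * r) * (n + 2 * r)) : ℕ) : ℕ∞) := by
  -- The window around the box meets `n + 2 * r` rows, and its entries are at most `n + 2 * r - 1`
  -- doublings away from column `-r`. Rounding that column to `n + 3 * r` binary digits therefore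
  -- leaves an error below `2 ^ (-r)`.
  set M := n + 3 * r
  let y : (Fin (n + 2 * r) → Fin (2 ^ M)) → principalSystem xSubTwo := fun f =>
    rowPoint r fun i => if h : (i + r).toNat < n + 2 * r then
      ((f ⟨(i + r).toNat, h⟩ : ℕ) : ℝ) / 2 ^ M else 0
  have hspan : IsSpanning (principalSystem xSubTwo) U n (Set.range y) := by
    intro x
    have hrep : ∀ i : ℤ, ∃ u ∈ Set.Ico (0 : ℝ) 1, (u : UnitAddCircle) = x.1 (-r, i) := fun i =>
      AddCircle.eq_coe_Ico _
    choose u hu hux using hrep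
    have hfl : ∀ i, ⌊u i * 2 ^ M⌋₊ < 2 ^ M := fun i => by
      rw [Nat.floor_lt (mul_nonneg (hu i).1 (by positivity))]
      push_cast
      exact mul_lt_of_lt_one_left (by positivity) (hu i).2
    refine ⟨_, ⟨fun j => ⟨⌊u ((j : ℕ) - r) * 2 ^ M⌋₊, hfl _⟩, rfl⟩, ?_⟩
    rintro ⟨k, l⟩ hkl
    simp only [box, Set.mem_prod, Set.mem_Ico] at hkl
    refine hr _ _ fun m i hm hi => ?_
    rw [abs_le] at hm hi
    rw [shift_apply, shift_apply]
    simp only [Prod.mk_add_mk, y, rowPoint_apply]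
    have hrow : (l + i + r).toNat < n + 2 * r := by omega
    have hrow' : (((l + i + r).toNat : ℕ) : ℤ) - r = l + i := by omega
    obtain ⟨q, hq⟩ := Int.eq_ofNat_of_zero_le (show 0 ≤ k + m + r by omega)
    have hx : x.1 (k + m, l + i) = (((2 : ℝ) ^ q * u (l + i) : ℝ) : UnitAddCircle) := by
      have h1 := principalSystem_apply_add x (-r) (l + i) q
      have e : (-(r : ℤ) + (q : ℤ)) = k + m := by omega
      rw [e, ← hux, ← AddCircle.coe_nsmul] at h1
      rw [h1, nsmul_eq_mul]
      push_cast
      rfl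
    rw [dif_pos hrow, hrow', hx, hq, dist_eq_norm, ← AddCircle.coe_sub]
    refine (norm_coe_unitAddCircle_le _).trans_lt ?_
    rw [zpow_natCast, ← mul_sub, abs_mul, abs_of_pos (by positivity : (0 : ℝ) < 2 ^ q)]
    have h3 : |u (l + i) - (⌊u (l + i) * 2 ^ M⌋₊ : ℝ) / 2 ^ M| ≤ 1 / 2 ^ M := by
      have h4 := Nat.floor_le (mul_nonneg (hu (l + i)).1 (by positivity : (0 : ℝ) ≤ 2 ^ M))
      have h5 := Nat.lt_floor_add_one (u (l + i) * 2 ^ M)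
      have e3 : u (l + i) - (⌊u (l + i) * 2 ^ M⌋₊ : ℝ) / 2 ^ M =
          (u (l + i) * 2 ^ M - ⌊u (l + i) * 2 ^ M⌋₊) / 2 ^ M := by
        field_simp
      rw [e3, abs_div, abs_of_pos (by positivity : (0 : ℝ) < 2 ^ M), abs_of_nonneg (by linarith)]
      gcongr
      linarith
    have h6 : (2 : ℝ) ^ q < 2 ^ (n + 2 * r) := pow_lt_pow_right₀ (by norm_num) (by omega)
    calc _ ≤ (2 : ℝ) ^ q * (1 / 2 ^ M) := by gcongr
      _ < 2 ^ (n + 2 * r) * (1 / 2 ^ M) := by gcongr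
      _ = (1 / 2) ^ r := by
        have : M = (n + 2 * r) + r := by omega
        rw [this, pow_add 2 (n + 2 * r) r, one_div_pow]
        field_simp
  refine (iInf_le _ ⟨_, hspan⟩).trans ?_
  change (Set.range y).encard ≤ _
  rw [← Set.image_univ]
  refine (Set.encard_image_le _ _).trans (le_of_eq ?_)
  rw [Set.encard_univ, ENat.card_eq_coe_natCard, Nat.card_fun]
  simp [pow_mul]

/-- The entourage of pairs whose coordinates at the origin are at distance less than `1 / 4`. -/
def originEntourage : Set (principalSystem xSubTwo × principalSystem xSubTwo) :=
  {p | dist (p.1.1 (0, 0)) (p.2.1 (0, 0)) < 1 / 4}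

theorem originEntourage_mem : originEntourage ∈ 𝓤 (principalSystem xSubTwo) := by
  have h : UniformContinuous fun x : principalSystem xSubTwo => x.1 (0, 0) :=
    (Pi.uniformContinuous_proj _ _).comp uniformContinuous_subtype_val
  exact h (Metric.dist_mem_uniformity (by norm_num : (0 : ℝ) < 1 / 4))

theorem le_spanningNumber (n : ℕ) :
    ((2 ^ (n * n) : ℕ) : ℕ∞) ≤
      spanningNumber (principalSystem xSubTwo) originEntourage n := by
  refine le_iInf fun ⟨s, hs⟩ => ?_
  let z : (Fin n → Fin (2 ^ n)) → principalSystem xSubTwo := fun f =>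
    rowPoint 0 fun i => if h : i.toNat < n then ((f ⟨i.toNat, h⟩ : ℕ) : ℝ) / 2 ^ n else 0
  choose y hys hy using fun f => hs (z f)
  -- Two points `z f`, `z g` shadowed by the same point differ by less than `1 / 4 + 1 / 4`
  -- throughout the box, so `eq_zero_of_norm_lt_half` applies in each row.
  have hinj : Function.Injective y := by
    intro f g hfg
    funext j
    have hd : ((f j : ℕ) : ℤ) - ((g j : ℕ) : ℤ) = 0 := by
      refine eq_zero_of_norm_lt_half (n := n) ?_ fun m hm => ?_
      · have h1 : ((f j : ℕ) : ℤ) < 2 ^ n := by exact_mod_cast (f j).2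
        have h2 : ((g j : ℕ) : ℤ) < 2 ^ n := by exact_mod_cast (g j).2
        rw [abs_lt]
        constructor <;> omega
      · have hbox : ((m : ℤ), ((j : ℕ) : ℤ)) ∈ box n := by
          simp only [box, Set.mem_prod, Set.mem_Ico]
          omega
        have h1 := hy f _ hbox
        have h2 := hy g _ hbox
        rw [← hfg] at h2
        simp only [originEntourage, Set.mem_ofPred_eq, shift_apply] at h1 h2
        have h3 := (dist_triangle_right _ _ _).trans_lt (add_lt_add h1 h2)
        simp only [Prod.mk_add_mk, add_zero, z, rowPoint_apply, Int.toNat_natCast, j.2,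
          dif_pos, dist_eq_norm, ← AddCircle.coe_sub, zpow_natCast, ← mul_sub, ← sub_div] at h3
        push_cast
        refine h3.trans_le (by norm_num)
    exact Fin.ext (by omega)
  have hcard : (Set.univ : Set (Fin n → Fin (2 ^ n))).encard ≤ s.encard :=
    Set.encard_le_encard_of_injOn (fun f _ => hys f) hinj.injOn
  rw [Set.encard_univ, ENat.card_eq_coe_natCard, Nat.card_fun] at hcard
  simpa [pow_mul] using hcard

theorem topologicalEntropy_xSubTwo :
    topologicalEntropy (principalSystem xSubTwo) = ((Real.log 2 : ℝ) : EReal) := by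
  have hlog : ∀ k : ℕ, ENNReal.log ((((2 ^ k : ℕ) : ℕ∞) : ℝ≥0∞)) =
      ((k * Real.log 2 : ℝ) : EReal) := fun k => by
    rw [ennreal_log_natCast (by positivity), Nat.cast_pow, Real.log_pow, Nat.cast_ofNat]
  apply le_antisymm
  · refine iSup₂_le fun U hU => ?_
    obtain ⟨r, hr⟩ := exists_window hU
    have hlim : Tendsto (fun n : ℕ =>
        (((1 + (3 * r : ℕ) / n) * (1 + (2 * r : ℕ) / n) * Real.log 2 : ℝ) : EReal)) atTop
        (𝓝 ((Real.log 2 : ℝ) : EReal)) := by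
      refine (continuous_coe_real_ereal.tendsto _).comp ?_
      have h1 := fun k : ℕ => (tendsto_const_div_atTop_nhds_zero_nat (k : ℝ)).const_add 1
      simpa using ((h1 (3 * r)).mul (h1 (2 * r))).mul_const (Real.log 2)
    rw [← hlim.limsup_eq]
    refine limsup_le_limsup ?_
    filter_upwards [eventually_ge_atTop 1] with n hn
    have h1 := ENNReal.log_le_log (ENat.toENNReal_le.2 (spanningNumber_le hr n))
    rw [hlog] at h1
    refine (EReal.div_le_div_right_of_nonneg (by positivity) h1).trans (le_of_eq ?_)
    rw [← EReal.coe_natCast, ← EReal.coe_div]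
    congr 1
    have : (n : ℝ) ≠ 0 := by positivity
    push_cast
    field_simp
  · refine le_trans ?_ (le_iSup₂ (f := fun U _ => limsup (fun n : ℕ =>
      ENNReal.log (spanningNumber (principalSystem xSubTwo) U n : ℝ≥0∞) / ((n ^ 2 : ℕ) : EReal))
      atTop) originEntourage originEntourage_mem)
    refine le_limsup_of_frequently_le' (Eventually.frequently ?_)
    filter_upwards [eventually_ge_atTop 1] with n hn
    have h1 := ENNReal.log_le_log (ENat.toENNReal_le.2 (le_spanningNumber n))
    rw [hlog] at h1
    refine le_trans (le_of_eq ?_) (EReal.div_le_div_right_of_nonneg (by positivity) h1)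
    rw [← EReal.coe_natCast, ← EReal.coe_div]
    congr 1
    have : (n : ℝ) ≠ 0 := by positivity
    push_cast
    field_simp

end OrbitGrowth

theorem mainTheorem4 :
    -- `x - 2` is not constant
    (∀ n : ℤ, OrbitGrowth.xSubTwo ≠ AddMonoidAlgebra.single (0, 0) n) ∧
    -- the entropy `h`, and the Mahler measure `𝗆(𝕋²)`
    OrbitGrowth.topologicalEntropy (OrbitGrowth.principalSystem OrbitGrowth.xSubTwo)
      = ((Real.log 2 : ℝ) : EReal) ∧
    OrbitGrowth.haarMean OrbitGrowth.xSubTwo OrbitGrowth.wholeTorus = Real.log 2 ∧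
    -- the means over the subgroups `J(a)` and `J(b, c)`
    (∀ a : ℕ, 1 ≤ a → OrbitGrowth.haarMean OrbitGrowth.xSubTwo (OrbitGrowth.J₁ a)
      = 1 / (a : ℝ) * Real.log (2 ^ a - 1)) ∧
    (∀ b c : ℕ, 1 ≤ c →
      OrbitGrowth.haarMean OrbitGrowth.xSubTwo (OrbitGrowth.J₂ b c) = Real.log 2) ∧
    -- the upper growth rate `g`, also as a supremum over the infinite compact subgroups
    OrbitGrowth.upperGrowthRate (ℤ × ℤ) (OrbitGrowth.principalSystem OrbitGrowth.xSubTwo)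
      = ((Real.log 2 : ℝ) : EReal) ∧
    IsLUB {r : ℝ | ∃ K : ClosedAddSubgroup OrbitGrowth.Torus,
      (K : Set OrbitGrowth.Torus).Infinite ∧ r = OrbitGrowth.haarMean OrbitGrowth.xSubTwo K}
      (Real.log 2) ∧
    -- the number of periodic points `F(L(a, b, c))`
    (∀ a b c : ℕ, 1 ≤ a → 1 ≤ c → b ≤ a - 1 →
      OrbitGrowth.periodicCount (OrbitGrowth.principalSystem OrbitGrowth.xSubTwo)
        (OrbitGrowth.lattice a b c) = (((2 ^ a - 1) ^ c : ℕ) : ℕ∞)) ∧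
    -- linear growth of `𝓜(N)`
    ∃ C₁₁ C₁₂ : ℝ, 0 < C₁₁ ∧ 0 < C₁₂ ∧ ∀ᶠ N : ℕ in Filter.atTop,
      ENNReal.ofReal (C₁₁ * N) ≤ OrbitGrowth.weightedOrbitSum (ℤ × ℤ)
        (OrbitGrowth.principalSystem OrbitGrowth.xSubTwo) N ∧
      OrbitGrowth.weightedOrbitSum (ℤ × ℤ)
        (OrbitGrowth.principalSystem OrbitGrowth.xSubTwo) N ≤ ENNReal.ofReal (C₁₂ * N) := by
  exact ⟨OrbitGrowth.xSubTwo_ne_single, OrbitGrowth.topologicalEntropy_xSubTwo,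
    OrbitGrowth.haarMean_wholeTorus, fun _ ha => OrbitGrowth.haarMean_J₁ ha,
    fun b _ hc => OrbitGrowth.haarMean_J₂ b hc, OrbitGrowth.upperGrowthRate_xSubTwo,
    OrbitGrowth.isLUB_haarMean, fun _ b _ ha hc _ => OrbitGrowth.periodicCount_lattice b ha hc,
    OrbitGrowth.weightedOrbitSum_linear_growth⟩
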